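/- Let $A$ be a (commutative) noetherian ring and let $f = u^n + a_1 u^{n-1} + \cdots + a_n \in A[u]$ be a monic polynomial of degree $n \ge 0$ with discriminant $\Delta \in A$. Let $$B = \mathrm{Split}_A(f) = A[\xi_1,\dots,\xi_n]/\bigl(a_i - (-1)^i e_i(\xi_1,\dots,\xi_n) : 1 \le i \le n\bigr)$$ be the splitting ring of $f$, where $e_i$ is the $i$th elementary symmetric polynomial. Then: (a) As an $A$-module, $B$ is free of rank $n!$. (b) The map $A \to B$ is syntomic, i.e., it is flat, of finite presentation, and for every prime $\mathfrak{p}$ of $A$ the fiber $B \otimes_A \kappa(\mathfrak{p})$ is a local complete intersection over $\kappa(\mathfrak{p})$. (c) For every integer $k \ge 0$, if $A$ satisfies Serre's condition $(S_k)$ (that is, $\operatorname{depth} A_{\mathfrak p} \ge \min(k, \dim A_{\mathfrak p})$ for every prime $\mathfrak p$ of $A$), then so does $B$. In particular, if $A$ is Cohen--Macaulay, then so is $B$. (d) If $\Delta$ is a unit of $A$, then $A \to B$ is étale. (e) If $A$ is reduced and $\Delta$ is a non-zerodivisor of $A$, then $B$ is reduced. (f) The map $A \to B$ admits an $A$-linear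 splitting, i.e., there is an $A$-linear map $s \colon B \to A$ whose composition with $A \to B$ is the identity of $A$. -/

import Mathlib

open Polynomial

universe u v

section SplittingRing

variable {A : Type u} [CommRing A]

/-- For `f = u ^ n + a₁ u ^ (n - 1) + ⋯ + aₙ` this is the ideal of `A[ξ₁, …, ξₙ]` generated by
`aᵢ - (-1) ^ i eᵢ(ξ₁, …, ξₙ)` for `1 ≤ i ≤ n` (below `i` is written as `j + 1` with `j : Fin n`),
where `eᵢ` is the `i`-th elementary symmetric polynomial. -/
noncomputable def splittingIdeal (n : ℕ) (f : A[X]) : Ideal (MvPolynomial (Fin n) A) :=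
  Ideal.span (Set.range fun j : Fin n =>
    MvPolynomial.C (f.coeff (n - (j.val + 1))) -
      (-1) ^ (j.val + 1) * MvPolynomial.esymm (Fin n) A (j.val + 1))

/-- The splitting ring of the monic polynomial `f` of degree `n`. -/
abbrev SplittingRing (n : ℕ) (f : A[X]) : Type u :=
  MvPolynomial (Fin n) A ⧸ splittingIdeal n f

end SplittingRing

section Syntomic

/-- A global complete intersection over a field `k`: the zero ring, or a ring of the form
`k[x₁, …, xₘ] / (g₁, …, g_c)` of Krull dimension `m - c`. -/
def IsGlobalCompleteIntersection (k : Type u) (S : Type v) [Field k] [CommRing S]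
    [Algebra k S] : Prop :=
  Subsingleton S ∨
    ∃ m c : ℕ, Nonempty (Algebra.Presentation k S (Fin m) (Fin c)) ∧
      ringKrullDim S + (c : WithBot ℕ∞) = (m : WithBot ℕ∞)

/-- A local complete intersection over a field `k`: a finite type `k`-algebra `S` whose spectrum is
covered by basic open sets `D(g)` such that every `S_g` is a global complete intersection. -/
structure IsLocalCompleteIntersection (k : Type u) (S : Type v) [Field k] [CommRing S]
    [Algebra k S] : Prop where
  finiteType : Algebra.FiniteType k S
  exists_cover : ∃ s : Set S, Ideal.span s = ⊤ ∧
    ∀ g ∈ s, IsGlobalCompleteIntersection k (Localization.Away g)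

/-- `R → S` is syntomic: flat, of finite presentation, and all fibres are local complete
intersections over the residue fields. -/
structure IsSyntomic (R : Type u) (S : Type v) [CommRing R] [CommRing S] [Algebra R S] : Prop where
  flat : Module.Flat R S
  finitePresentation : Algebra.FinitePresentation R S
  fiber : ∀ (p : Ideal R) [p.IsPrime], IsLocalCompleteIntersection p.ResidueField (p.Fiber S)

end Syntomic

section Serre

/-- The depth of a local ring: the supremum of the lengths of regular sequences in the maximal
ideal. -/
noncomputable def localDepth (R : Type u) [CommRing R] [IsLocalRing R] : ℕ∞ :=
  ⨆ (rs : List R) (_ : RingTheory.Sequence.IsRegular R rs)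
    (_ : ∀ r ∈ rs, r ∈ IsLocalRing.maximalIdeal R), (rs.length : ℕ∞)

/-- Serre's condition `(S_k)` for a ring `R`: `R` is noetherian and
`depth R_p ≥ min (k, dim R_p)` for every prime `p`. -/
structure SerreCondition (k : ℕ) (R : Type u) [CommRing R] : Prop where
  isNoetherianRing : IsNoetherianRing R
  min_le_depth : ∀ (p : Ideal R) [p.IsPrime],
    min (k : WithBot ℕ∞) (ringKrullDim (Localization.AtPrime p)) ≤
      (localDepth (Localization.AtPrime p) : WithBot ℕ∞)

/-- A Cohen–Macaulay ring: noetherian, with `depth R_p = dim R_p` for every prime `p`. -/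
structure IsCohenMacaulay (R : Type u) [CommRing R] : Prop where
  isNoetherianRing : IsNoetherianRing R
  depth_eq_dim : ∀ (p : Ideal R) [p.IsPrime],
    (localDepth (Localization.AtPrime p) : WithBot ℕ∞) = ringKrullDim (Localization.AtPrime p)

end Serre

/-! Adjoining one root splits off a linear factor, and `B` is again the splitting ring of the
cofactor over `A[x]/(f)` (`equivCofactor`). Induction yields a basis of `n!` elements containing
`1`; its coordinate at `1` is the splitting. As `B` has `n` generators and `n` relations, its
fibres, finite over a field, are complete intersections of dimension `0`. Flatness keeps depth from
dropping and integrality keeps dimension from growing, whence Serre's conditions. Finally `B` is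
generated by roots of `f`, and the discriminant lies in `(f, f')`: where it is invertible, `B` is
unramified. Reducedness is then tested on fibres over minimal primes. -/

theorem Polynomial.Monic.exists_mul_add_derivative_mul_eq_C_discr {R : Type*} [CommRing R]
    {f : R[X]} (hf : f.Monic) : ∃ p q : R[X], f * p + derivative f * q = C f.discr := by
  by_cases h0 : f.natDegree = 0
  · obtain rfl := eq_one_of_monic_natDegree_zero hf h0
    exact ⟨1, 0, by rw [← C_1, discr_C]; simp⟩
  obtain ⟨p, q, -, -, h⟩ := exists_mul_add_mul_eq_C_resultant (m := f.natDegree)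
    (n := f.natDegree - 1) f (derivative f) le_rfl (natDegree_derivative_le f) (Or.inl h0)
  rw [resultant_deriv (natDegree_pos_iff_degree_pos.mp (Nat.pos_of_ne_zero h0)),
    hf.leadingCoeff, mul_one, C_mul] at h
  -- The sign between resultant and discriminant is its own inverse.
  refine ⟨p * C ((-1) ^ (f.natDegree * (f.natDegree - 1) / 2)),
    q * C ((-1) ^ (f.natDegree * (f.natDegree - 1) / 2)), ?_⟩
  rw [← mul_assoc, ← mul_assoc, ← add_mul, h, mul_right_comm, ← C_mul, ← mul_pow]
  simp

theorem Polynomial.Monic.separable_map_of_isUnit_discr {R S : Type*} [CommRing R] [CommRing S]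
    {f : R[X]} (hf : f.Monic) (φ : R →+* S) (h : IsUnit (φ f.discr)) : (f.map φ).Separable := by
  obtain ⟨p, q, hpq⟩ := hf.exists_mul_add_derivative_mul_eq_C_discr
  obtain ⟨u, hu⟩ := h.exists_left_inv
  refine ⟨C u * p.map φ, C u * q.map φ, ?_⟩
  have := congrArg (fun r => C u * r.map φ) hpq
  simp only [Polynomial.map_add, Polynomial.map_mul, map_C, ← C_mul, hu, C_1] at this
  rw [derivative_map, ← this]
  ring

/-- An algebra generated by roots of separable polynomials is formally unramified. -/
theorem Algebra.FormallyUnramified.of_adjoin_eq_top_of_separable {R S : Type*} [CommRing R]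
    [CommRing S] [Algebra R S] {s : Set S} (hs : Algebra.adjoin R s = ⊤)
    (h : ∀ x ∈ s, ∃ f : R[X], f.Separable ∧ aeval x f = 0) : Algebra.FormallyUnramified R S := by
  suffices hD : KaehlerDifferential.D R S = 0 by
    refine ⟨⟨fun a b => ?_⟩⟩
    have key : ∀ c : Ω[S⁄R], c = 0 := fun c => by
      have : c ∈ Submodule.span S (Set.range (KaehlerDifferential.D R S)) := by
        rw [KaehlerDifferential.span_range_derivation]; trivial
      rw [show Set.range (KaehlerDifferential.D R S) = {0} by
        rw [hD]; ext; simp, Submodule.span_zero_singleton] at this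
      simpa using this
    rw [key a, key b]
  refine Derivation.ext_of_adjoin_eq_top s hs fun x hx => ?_
  obtain ⟨f, ⟨p, q, hpq⟩, hfx⟩ := h x hx
  -- `f'(x)` is a unit, while `0 = d(f(x)) = f'(x) dx`.
  have h1 : aeval x q * aeval x (derivative f) = 1 := by
    simpa [hfx] using congrArg (aeval x) hpq
  have h2 : aeval x (derivative f) • KaehlerDifferential.D R S x = 0 := by
    rw [← Derivation.map_aeval, hfx, map_zero]
  rw [Derivation.zero_apply, ← one_smul S (KaehlerDifferential.D R S x), ← h1, mul_smul, h2,
    smul_zero]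

/-- A free algebra over a reduced ring is reduced if its fibres over the minimal primes are. -/
theorem isReduced_of_free_of_fiber {R S : Type*} [CommRing R] [CommRing S] [Algebra R S]
    [Module.Free R S] [IsReduced R]
    (h : ∀ (p : Ideal R) [p.IsPrime], p ∈ minimalPrimes R → IsReduced (p.Fiber S)) :
    IsReduced S := by
  refine ⟨fun x hx => ?_⟩
  let b := Module.Free.chooseBasis R S
  refine b.ext_elem fun i => ?_
  -- The minimal primes of a reduced ring intersect in `0`, so each coordinate may be tested in
  -- their residue fields.
  rw [map_zero, Finsupp.zero_apply, ← Ideal.mem_bot,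
    ← show (⊥ : Ideal R).radical = ⊥ from nilradical_eq_zero R, ← Ideal.sInf_minimalPrimes]
  refine Submodule.mem_sInf.mpr fun (p : Ideal R) hp => ?_
  have := hp.1.1
  have := h p hp
  have h0 : (Algebra.TensorProduct.includeRight (R := R) (A := p.ResidueField) (B := S)) x = 0 :=
    (hx.map _).eq_zero
  have h1 := congrArg (fun y => (b.baseChange p.ResidueField).repr y i) h0
  simpa [Algebra.smul_def] using h1

theorem IsReduced.of_free_of_adjoin_eq_top {R S : Type*} [CommRing R] [CommRing S] [Algebra R S]
    [Module.Free R S] [Module.Finite R S] [IsReduced R] {s : Set S}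
    (hs : Algebra.adjoin R s = ⊤) {f : R[X]} (hf : f.Monic) (hd : f.discr ∈ nonZeroDivisors R)
    (h : ∀ x ∈ s, aeval x f = 0) : IsReduced S := by
  refine isReduced_of_free_of_fiber (R := R) fun p _ hp => ?_
  -- Minimal primes contain no non-zerodivisors.
  have hu : IsUnit (algebraMap R p.ResidueField f.discr) := by
    rw [isUnit_iff_ne_zero, Ne, Ideal.algebraMap_residueField_eq_zero]
    exact fun hm => Set.disjoint_left.mp
      (Ideal.disjoint_nonZeroDivisors_of_mem_minimalPrimes hp) hm hd
  have : Algebra.FormallyUnramified p.ResidueField (p.Fiber S) := by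
    refine Algebra.FormallyUnramified.of_adjoin_eq_top_of_separable
      (Algebra.TensorProduct.adjoin_one_tmul_image_eq_top s hs) ?_
    rintro _ ⟨x, hx, rfl⟩
    refine ⟨_, hf.separable_map_of_isUnit_discr _ hu, ?_⟩
    rw [aeval_map_algebraMap]
    change aeval (Algebra.TensorProduct.includeRight (R := R) (A := p.ResidueField) x) f = 0
    rw [aeval_algHom_apply, h x hx, map_zero]
  exact Algebra.FormallyUnramified.isReduced_of_field p.ResidueField _

/-! ### Depth and dimension along finite flat maps -/

theorem Ideal.height_le_height_under_of_isIntegral {R S : Type*} [CommRing R] [CommRing S]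
    [Algebra R S] [Algebra.IsIntegral R S] (q : Ideal S) [q.IsPrime] :
    q.height ≤ (q.under R).height := by
  have : StrictMono (PrimeSpectrum.comap (algebraMap R S)) :=
    fun I J h => Ideal.IsIntegral.comap_lt_comap (I := I.asIdeal) (J := J.asIdeal) h
  have h := Order.height_le_height_apply_of_strictMono _ this ⟨q, inferInstance⟩
  rwa [← PrimeSpectrum.height_eq_orderHeight, ← PrimeSpectrum.height_eq_orderHeight] at h

/-- A flat local map is faithfully flat, so it carries regular sequences to regular sequences. -/
theorem localDepth_le_of_flat {R S : Type u} [CommRing R] [CommRing S] [IsLocalRing R]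
    [IsLocalRing S] [Algebra R S] [Module.Flat R S] [IsLocalHom (algebraMap R S)] :
    localDepth R ≤ localDepth S := by
  have : Module.FaithfullyFlat R S := .of_flat_of_isLocalHom
  refine iSup_le fun rs => iSup_le fun h => iSup_le fun hm => ?_
  refine le_trans (by simp) (le_iSup₂_of_le (rs.map (algebraMap R S)) h.of_faithfullyFlat
    (le_iSup_of_le ?_ le_rfl))
  intro r hr
  obtain ⟨a, ha, rfl⟩ := List.mem_map.mp hr
  exact map_nonunit (algebraMap R S) a (hm a ha)

/-- Each term of a regular sequence lowers the dimension by one, and the final quotient is nonzero.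
-/
theorem localDepth_le_ringKrullDim (R : Type u) [CommRing R] [IsLocalRing R] [IsNoetherianRing R] :
    (localDepth R : WithBot ℕ∞) ≤ ringKrullDim R := by
  obtain ⟨d, hd⟩ := WithBot.ne_bot_iff_exists.mp (ringKrullDim_ne_bot (R := R))
  rw [← hd, WithBot.coe_le_coe]
  refine iSup_le fun rs => iSup_le fun h => iSup_le fun _ => ?_
  rw [← WithBot.coe_le_coe, hd, ← ringKrullDim_add_length_eq_ringKrullDim_of_isRegular rs h]
  have : Nontrivial (R ⧸ Ideal.ofList rs) := Ideal.Quotient.nontrivial_iff.mpr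
    (by simpa using h.top_ne_smul.symm)
  exact le_add_of_nonneg_left ringKrullDim_nonneg_of_nontrivial

section

variable {R S : Type u} [CommRing R] [CommRing S] [Algebra R S] [Module.Flat R S]

theorem localDepth_under_le_of_flat (q : Ideal S) [q.IsPrime] :
    localDepth (Localization.AtPrime (q.under R)) ≤ localDepth (Localization.AtPrime q) := by
  let φ := Localization.localRingHom (q.under R) q (algebraMap R S) rfl
  have hφ : φ.Flat := RingHom.Flat.localRingHom (RingHom.flat_algebraMap_iff.mpr ‹_›) _ _ rfl
  let := φ.toAlgebra
  have : Module.Flat (Localization.AtPrime (q.under R)) (Localization.AtPrime q) := hφ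
  have : IsLocalHom (algebraMap (Localization.AtPrime (q.under R)) (Localization.AtPrime q)) :=
    inferInstanceAs (IsLocalHom φ)
  exact localDepth_le_of_flat

theorem ringKrullDim_localization_le_under_of_isIntegral {R S : Type*} [CommRing R] [CommRing S]
    [Algebra R S] [Algebra.IsIntegral R S] (q : Ideal S) [q.IsPrime] :
    ringKrullDim (Localization.AtPrime q) ≤ ringKrullDim (Localization.AtPrime (q.under R)) := by
  rw [IsLocalization.AtPrime.ringKrullDim_eq_height q,
    IsLocalization.AtPrime.ringKrullDim_eq_height (q.under R), WithBot.coe_le_coe]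
  exact q.height_le_height_under_of_isIntegral

end

section

variable {R S : Type u} [CommRing R] [CommRing S] [Algebra R S] [Module.Flat R S]
  [Module.Finite R S]

theorem SerreCondition.of_flat_of_finite {k : ℕ} (h : SerreCondition k R) :
    SerreCondition k S := by
  have := h.isNoetherianRing
  refine ⟨IsNoetherianRing.of_finite R S, fun q _ => ?_⟩
  exact (min_le_min le_rfl (ringKrullDim_localization_le_under_of_isIntegral (R := R) q)).trans
    ((h.min_le_depth (q.under R)).trans (WithBot.coe_le_coe.mpr (localDepth_under_le_of_flat q)))

theorem IsCohenMacaulay.of_flat_of_finite (h : IsCohenMacaulay R) : IsCohenMacaulay S := by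
  have := h.isNoetherianRing
  have : IsNoetherianRing S := IsNoetherianRing.of_finite R S
  refine ⟨this, fun q _ => (localDepth_le_ringKrullDim _).antisymm ?_⟩
  exact (ringKrullDim_localization_le_under_of_isIntegral (R := R) q).trans
    ((h.depth_eq_dim (q.under R)).ge.trans (WithBot.coe_le_coe.mpr (localDepth_under_le_of_flat q)))

end

/-! ### Universal property and freeness of the splitting ring -/

namespace SplittingRing

variable {A : Type u} [CommRing A] {n : ℕ} {f : A[X]}

/-- The `i`-th universal root `ξᵢ`. -/
noncomputable def root (n : ℕ) (f : A[X]) (i : Fin n) : SplittingRing n f :=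
  Ideal.Quotient.mk _ (MvPolynomial.X i)

theorem coeff_prod_X_sub_C {R : Type*} [CommRing R] (x : Fin n → R) {k : ℕ} (hk : k ≤ n) :
    (∏ i, (X - C (x i))).coeff (n - k) = (-1) ^ k * (Finset.univ.val.map x).esymm k := by
  have := Multiset.prod_X_sub_C_coeff (Finset.univ.val.map x) (k := n - k) (by simp)
  rwa [Multiset.map_map, Multiset.card_map, Finset.card_val, Finset.card_univ, Fintype.card_fin,
    Nat.sub_sub_self hk] at this

/-- Vieta's formulas: this translates between the defining relations of the splitting ring and a
factorisation. -/
theorem monic_eq_prod_X_sub_C_iff {R : Type*} [CommRing R] {g : R[X]} (hg : g.Monic)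
    (hn : g.natDegree = n) (x : Fin n → R) :
    g = ∏ i, (X - C (x i)) ↔
      ∀ j : Fin n, g.coeff (n - (j + 1)) = (-1) ^ (j + 1 : ℕ) *
        (Finset.univ.val.map x).esymm (j + 1) := by
  constructor
  · rintro rfl j
    exact coeff_prod_X_sub_C x j.2
  · intro h
    ext k
    rcases lt_trichotomy k n with hk | hk | hk
    · have := h ⟨n - 1 - k, by omega⟩
      simp only at this
      rw [← coeff_prod_X_sub_C x (by omega)] at this
      rwa [show n - (n - 1 - k + 1) = k by omega] at this
    · have := coeff_prod_X_sub_C x (Nat.zero_le n)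
      rw [hk, show g.coeff n = 1 from hn ▸ hg.coeff_natDegree]
      simpa [Multiset.esymm] using this.symm
    · nontriviality R
      rw [coeff_eq_zero_of_natDegree_lt (hn ▸ hk), coeff_eq_zero_of_natDegree_lt]
      rwa [natDegree_prod_of_monic _ _ fun i _ => monic_X_sub_C _, Finset.sum_congr rfl
        fun i _ => natDegree_X_sub_C _, Finset.sum_const, Finset.card_univ, Fintype.card_fin,
        smul_eq_mul, mul_one]

theorem map_eq_prod_X_sub_C_root (hf : f.Monic) (hn : f.natDegree = n) :
    f.map (algebraMap A (SplittingRing n f)) = ∏ i, (X - C (root n f i)) := by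
  nontriviality SplittingRing n f
  refine (monic_eq_prod_X_sub_C_iff (hf.map _) (by rw [hf.natDegree_map, hn]) _).mpr fun j => ?_
  have h : (Ideal.Quotient.mk (splittingIdeal n f)) (MvPolynomial.C (f.coeff (n - (j.val + 1))) -
      (-1) ^ (j.val + 1) * MvPolynomial.esymm (Fin n) A (j.val + 1)) = 0 :=
    Ideal.Quotient.eq_zero_iff_mem.mpr (Ideal.subset_span ⟨j, rfl⟩)
  rw [map_sub, sub_eq_zero, map_mul, map_pow, map_neg, map_one] at h
  rw [coeff_map, ← MvPolynomial.aeval_esymm_eq_multiset_esymm (σ := Fin n) (R := A)]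
  refine h.trans ?_
  congr 1
  have : (Ideal.Quotient.mkₐ A (splittingIdeal n f)) = MvPolynomial.aeval (root n f) :=
    MvPolynomial.algHom_ext fun i => by simp [root]
  exact DFunLike.congr_fun this _

theorem aeval_root (hf : f.Monic) (hn : f.natDegree = n) (i : Fin n) :
    aeval (root n f i) f = 0 := by
  rw [← eval_map_algebraMap, map_eq_prod_X_sub_C_root hf hn, eval_prod]
  exact Finset.prod_eq_zero (Finset.mem_univ i) (by simp)

theorem adjoin_range_root : Algebra.adjoin A (Set.range (root n f)) = ⊤ := by
  have : Set.range (root n f) =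
      Ideal.Quotient.mkₐ A (splittingIdeal n f) '' Set.range MvPolynomial.X := by
    rw [← Set.range_comp]; rfl
  rw [this, ← AlgHom.map_adjoin, MvPolynomial.adjoin_range_X, Algebra.map_top,
    AlgHom.range_eq_top]
  exact Ideal.Quotient.mkₐ_surjective _ _

/-- The universal property of the splitting ring. -/
noncomputable def lift {R : Type*} [CommRing R] (φ : A →+* R) (x : Fin n → R)
    (hf : f.Monic) (hn : f.natDegree = n) (h : f.map φ = ∏ i, (X - C (x i))) :
    SplittingRing n f →+* R :=
  Ideal.Quotient.lift _ (MvPolynomial.eval₂Hom φ x) <| by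
    nontriviality R
    suffices splittingIdeal n f ≤ RingHom.ker (MvPolynomial.eval₂Hom φ x) from fun a ha => this ha
    refine Ideal.span_le.mpr ?_
    rintro _ ⟨j, rfl⟩
    have hj := (monic_eq_prod_X_sub_C_iff (hf.map φ) (by rw [hf.natDegree_map, hn]) x).mp h j
    rw [coeff_map] at hj
    let _ := φ.toAlgebra
    rw [← MvPolynomial.aeval_esymm_eq_multiset_esymm (σ := Fin n) (R := A)] at hj
    simp only [SetLike.mem_coe, RingHom.mem_ker, map_sub, map_mul, map_pow, map_neg, map_one,
      MvPolynomial.eval₂Hom_C, hj]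
    exact sub_self _

section lift

variable {R : Type*} [CommRing R] (φ : A →+* R) (x : Fin n → R)
    (hf : f.Monic) (hn : f.natDegree = n) (h : f.map φ = ∏ i, (X - C (x i)))

@[simp] theorem lift_root (i : Fin n) : lift φ x hf hn h (root n f i) = x i := by
  simp [lift, root]

@[simp] theorem lift_algebraMap (a : A) : lift φ x hf hn h (algebraMap A _ a) = φ a := by
  change lift φ x hf hn h (Ideal.Quotient.mk _ (MvPolynomial.C a)) = φ a
  simp [lift]

end lift

theorem ringHom_ext {R : Type*} [CommRing R] {φ ψ : SplittingRing n f →+* R}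
    (h : ∀ a, φ (algebraMap A _ a) = ψ (algebraMap A _ a))
    (h' : ∀ i, φ (root n f i) = ψ (root n f i)) : φ = ψ :=
  Ideal.Quotient.ringHom_ext (MvPolynomial.ringHom_ext h h')

section succ

/-- The cofactor of the linear factor of `f` over `A[x] / (f)`. -/
noncomputable def cofactor (f : A[X]) : (AdjoinRoot f)[X] :=
  f.map (AdjoinRoot.of f) /ₘ (X - C (AdjoinRoot.root f))

theorem X_sub_C_root_mul_cofactor (f : A[X]) :
    (X - C (AdjoinRoot.root f)) * cofactor f = f.map (AdjoinRoot.of f) :=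
  mul_divByMonic_eq_iff_isRoot.mpr (by simp [IsRoot.def, eval_map])

theorem monic_cofactor (hf : f.Monic) : (cofactor f).Monic :=
  (monic_X_sub_C _).of_mul_monic_left (by rw [X_sub_C_root_mul_cofactor]; exact hf.map _)

theorem natDegree_cofactor [Nontrivial (AdjoinRoot f)] (hf : f.Monic) (hn : f.natDegree = n + 1) :
    (cofactor f).natDegree = n := by
  have := congrArg natDegree (X_sub_C_root_mul_cofactor f)
  rw [(monic_X_sub_C _).natDegree_mul (monic_cofactor hf), natDegree_X_sub_C, hf.natDegree_map,
    hn] at this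
  omega

/-- The map `A[x] / (f) → Split_A(f)` sending `x` to the `i`-th universal root. -/
noncomputable def adjoinRootHom (hf : f.Monic) (hn : f.natDegree = n) (i : Fin n) :
    AdjoinRoot f →+* SplittingRing n f :=
  AdjoinRoot.lift (algebraMap A (SplittingRing n f)) (root n f i) (aeval_root hf hn i)

@[simp] theorem adjoinRootHom_root (hf : f.Monic) (hn : f.natDegree = n) (i : Fin n) :
    adjoinRootHom hf hn i (AdjoinRoot.root f) = root n f i :=
  AdjoinRoot.lift_root (aeval_root hf hn i)

@[simp] theorem adjoinRootHom_of (hf : f.Monic) (hn : f.natDegree = n) (i : Fin n) (a : A) :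
    adjoinRootHom hf hn i (AdjoinRoot.of f a) = algebraMap A (SplittingRing n f) a :=
  AdjoinRoot.lift_of (aeval_root hf hn i)

/-- The monic factor `X - ξ₀` can be cancelled from two factorisations of `f`. -/
theorem map_cofactor_eq (hf : f.Monic) (hn : f.natDegree = n + 1) :
    (cofactor f).map (adjoinRootHom hf hn 0) = ∏ i : Fin n, (X - C (root (n + 1) f i.succ)) := by
  apply (monic_X_sub_C (root (n + 1) f 0)).isRegular.left
  have := congrArg (map (adjoinRootHom hf hn 0)) (X_sub_C_root_mul_cofactor f)
  rw [Polynomial.map_mul, map_map, show (adjoinRootHom hf hn 0).comp (AdjoinRoot.of f) =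
    algebraMap A _ from RingHom.ext (adjoinRootHom_of hf hn 0), map_eq_prod_X_sub_C_root hf hn,
    Fin.prod_univ_succ] at this
  simpa using this

variable [Nontrivial (AdjoinRoot f)]

theorem map_eq_prod_cons (hf : f.Monic) (hn : f.natDegree = n + 1) :
    f.map (algebraMap A (SplittingRing n (cofactor f))) =
      ∏ i, (X - C (Fin.cons (α := fun _ => SplittingRing n (cofactor f))
        (algebraMap _ _ (AdjoinRoot.root f)) (root n (cofactor f)) i)) := by
  rw [Fin.prod_univ_succ]
  simp only [Fin.cons_zero, Fin.cons_succ]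
  rw [← map_eq_prod_X_sub_C_root (monic_cofactor hf) (natDegree_cofactor hf hn),
    IsScalarTower.algebraMap_eq A (AdjoinRoot f), ← map_map, AdjoinRoot.algebraMap_eq,
    ← X_sub_C_root_mul_cofactor, Polynomial.map_mul]
  simp

/-- The splitting ring of `f` is the splitting ring of the cofactor of the universal root. -/
noncomputable def equivCofactor (hf : f.Monic) (hn : f.natDegree = n + 1) :
    SplittingRing n (cofactor f) ≃ₐ[A] SplittingRing (n + 1) f :=
  AlgEquiv.ofRingEquiv (f := RingEquiv.ofRingHom
    (lift _ _ (monic_cofactor hf) (natDegree_cofactor hf hn) (map_cofactor_eq hf hn))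
    (lift _ _ hf hn (map_eq_prod_cons hf hn))
    (ringHom_ext (by simp [IsScalarTower.algebraMap_apply A (AdjoinRoot f),
      AdjoinRoot.algebraMap_eq]) (fun i => by
      refine Fin.cases ?_ (fun j => ?_) i <;> simp))
    -- Here the base is `A[x]/(f)`, so agreement on it is in turn checked on `A` and the adjoined
    -- root.
    (ringHom_ext (fun a => DFunLike.congr_fun (AdjoinRoot.ringHom_ext (f := ((lift _ _ hf hn
      (map_eq_prod_cons hf hn)).comp (lift _ _ (monic_cofactor hf) (natDegree_cofactor hf hn)
      (map_cofactor_eq hf hn))).comp (algebraMap _ _)) (g := algebraMap _ _)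
      (RingHom.ext fun a => by simp [IsScalarTower.algebraMap_apply A (AdjoinRoot f),
        AdjoinRoot.algebraMap_eq]) (by simp)) a) (by simp)))
    (by simp [IsScalarTower.algebraMap_apply A (AdjoinRoot f), AdjoinRoot.algebraMap_eq])

end succ

/-- The induction changes the base to `A[x]/(f)`, hence the quantification over all rings. -/
theorem exists_basis_apply_eq_one (n : ℕ) : ∀ {A : Type u} [CommRing A] {f : A[X]}, f.Monic →
    f.natDegree = n →
    ∃ (b : Module.Basis (Fin n.factorial) A (SplittingRing n f)) (i : Fin n.factorial), b i = 1 := by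
  induction n with
  | zero =>
    intro A _ f hf hn
    have hb : Function.Bijective (algebraMap A (SplittingRing 0 f)) := by
      have hI : splittingIdeal 0 f = ⊥ := by simp [splittingIdeal]
      refine Function.Bijective.comp (f := MvPolynomial.C (σ := Fin 0))
        (g := Ideal.Quotient.mk (splittingIdeal 0 f))
        ⟨?_, Ideal.Quotient.mk_surjective⟩
        ⟨MvPolynomial.C_injective _ _, MvPolynomial.C_surjective _⟩
      rw [RingHom.injective_iff_ker_eq_bot, Ideal.mk_ker, hI]
    let e := finCongr Nat.factorial_zero.symm
    let c : Module.Basis (Fin 1) A (SplittingRing 0 f) := (Module.Basis.singleton (Fin 1) A).map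
      (AlgEquiv.ofBijective (Algebra.ofId A (SplittingRing 0 f)) hb).toLinearEquiv
    refine ⟨c.reindex e, e 0, ?_⟩
    rw [Module.Basis.reindex_apply, Equiv.symm_apply_apply, Module.Basis.map_apply,
      Module.Basis.singleton_apply]
    exact map_one (Algebra.ofId A (SplittingRing 0 f))
  | succ n ih =>
    intro A _ f hf hn
    rcases subsingleton_or_nontrivial A with hA | hA
    -- The degree of the cofactor is only controlled over a nonzero ring.
    · have := Module.subsingleton A (SplittingRing (n + 1) f)
      exact ⟨⟨0⟩, ⟨0, Nat.factorial_pos _⟩, Subsingleton.elim _ _⟩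
    have : Nontrivial (AdjoinRoot f) := by
      have : Nonempty (Fin (AdjoinRoot.powerBasis' hf).dim) :=
        ⟨⟨0, by rw [AdjoinRoot.powerBasis'_dim]; omega⟩⟩
      exact (AdjoinRoot.powerBasis' hf).basis.repr.symm.injective.nontrivial
    obtain ⟨b, i, hb⟩ := ih (monic_cofactor hf) (natDegree_cofactor hf hn)
    -- The `n + 1` powers of the root times `n!` elements; the zeroth power times `b i = 1` is `1`.
    let c := (AdjoinRoot.powerBasis' hf).basis.reindex (finCongr hn)
    let e := finProdFinEquiv.trans (finCongr (Nat.factorial_succ n).symm)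
    refine ⟨((c.smulTower b).map (equivCofactor hf hn).toLinearEquiv).reindex e, e (0, i), ?_⟩
    have hc : c 0 = 1 := by
      rw [Module.Basis.reindex_apply, PowerBasis.basis_eq_pow]
      exact pow_zero _
    rw [Module.Basis.reindex_apply, Equiv.symm_apply_apply, Module.Basis.map_apply,
      Module.Basis.smulTower_apply, hb, hc, one_smul]
    exact map_one (equivCofactor hf hn)

end SplittingRing

/-! ### Complete intersection fibres -/

theorem IsGlobalCompleteIntersection.of_presentation_of_finite {k : Type u} {S : Type v} [Field k]
    [CommRing S] [Algebra k S] [Module.Finite k S] {n : ℕ}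
    (P : Algebra.Presentation k S (Fin n) (Fin n)) : IsGlobalCompleteIntersection k S := by
  rcases subsingleton_or_nontrivial S with hS | hS
  · exact Or.inl hS
  -- Artinian and nonzero means dimension `0 = n - n`.
  · have : IsArtinianRing S := .of_finite k S
    exact Or.inr ⟨n, n, ⟨P⟩, by
      rw [ringKrullDimZero_iff_ringKrullDim_eq_zero.mp inferInstance, zero_add]⟩

theorem IsLocalCompleteIntersection.of_presentation_of_finite {k : Type u} {S : Type v} [Field k]
    [CommRing S] [Algebra k S] [Module.Finite k S] {n : ℕ}
    (P : Algebra.Presentation k S (Fin n) (Fin n)) : IsLocalCompleteIntersection k S := by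
  refine ⟨inferInstance, {1}, Ideal.span_singleton_one, ?_⟩
  rintro _ rfl
  let e : S ≃ₐ[k] Localization.Away (1 : S) :=
    (IsLocalization.atOne S (Localization.Away (1 : S))).restrictScalars k
  have : Module.Finite k (Localization.Away (1 : S)) := .equiv e.toLinearEquiv
  exact .of_presentation_of_finite (P.ofAlgEquiv e)

theorem IsSyntomic.of_presentation_of_flat_of_finite {R : Type u} {S : Type v} [CommRing R]
    [CommRing S] [Algebra R S] [Module.Flat R S] [Module.Finite R S] {n : ℕ}
    (P : Algebra.Presentation R S (Fin n) (Fin n)) : IsSyntomic R S :=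
  ⟨inferInstance, P.finitePresentation_of_isFinite,
    fun p _ => .of_presentation_of_finite (P.baseChange p.ResidueField)⟩

theorem mainTheorem9 {A : Type u} [CommRing A] [IsNoetherianRing A] (n : ℕ) (f : A[X])
    (hf : f.Monic) (hn : f.natDegree = n) :
    -- `B` is a free `A`-module of rank `n!`
    Nonempty (Module.Basis (Fin n.factorial) A (SplittingRing n f)) ∧
    -- `A → B` is syntomic
    IsSyntomic A (SplittingRing n f) ∧
    -- Serre's conditions and the Cohen–Macaulay property pass from `A` to `B`
    (∀ k : ℕ, SerreCondition k A → SerreCondition k (SplittingRing n f)) ∧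
    (IsCohenMacaulay A → IsCohenMacaulay (SplittingRing n f)) ∧
    -- if the discriminant is a unit then `A → B` is étale
    (IsUnit f.discr → Algebra.Etale A (SplittingRing n f)) ∧
    -- if `A` is reduced and the discriminant is a non-zerodivisor then `B` is reduced
    (IsReduced A → f.discr ∈ nonZeroDivisors A → IsReduced (SplittingRing n f)) ∧
    -- `A → B` has an `A`-linear left inverse
    (∃ s : SplittingRing n f →ₗ[A] A,
      s ∘ₗ Algebra.linearMap A (SplittingRing n f) = LinearMap.id) := by
  obtain ⟨b, i, hb⟩ := SplittingRing.exists_basis_apply_eq_one n hf hn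
  have : Module.Free A (SplittingRing n f) := .of_basis b
  have : Module.Finite A (SplittingRing n f) := .of_basis b
  have hs : IsSyntomic A (SplittingRing n f) :=
    -- The defining quotient already has as many relations as variables.
    .of_presentation_of_flat_of_finite (Algebra.Presentation.naive (R := A) (σ := Fin n))
  refine ⟨⟨b⟩, hs, fun k h => h.of_flat_of_finite, fun h => h.of_flat_of_finite, fun hd => ?_,
    fun _ hd => ?_, b.coord i, ?_⟩
  · have := hs.finitePresentation
    have : Algebra.FormallyUnramified A (SplittingRing n f) := by
      refine .of_adjoin_eq_top_of_separable SplittingRing.adjoin_range_root ?_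
      rintro _ ⟨j, rfl⟩
      refine ⟨f, ?_, SplittingRing.aeval_root hf hn j⟩
      simpa using hf.separable_map_of_isUnit_discr (RingHom.id A) hd
    exact Algebra.Etale.of_formallyUnramified_of_flat
  · refine .of_free_of_adjoin_eq_top SplittingRing.adjoin_range_root hf hd ?_
    rintro _ ⟨j, rfl⟩
    exact SplittingRing.aeval_root hf hn j
  · ext
    simp [← hb]
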